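/- **Integro-differential hierarchy of equations.** Let $A:\mathbb R\to\mathbb R$ be smooth and such that $A$ and each of its derivatives vanish exponentially fast at $+\infty$. Let $\sigma:\mathbb R\to\mathbb R$ be non-decreasing, smooth except at finitely many points, with $\sigma(t)\to 0$ as $t\to-\infty$ and $\sigma(t)\to\gamma\in(0,1]$ as $t\to+\infty$, exponentially fast. Let $\sigma'$ also denote the measure $d\sigma$ (the Stieltjes measure of $\sigma$). For $s\in\mathbb R$ and $p\in\mathbb N=\{0,1,2,\dots\}$ let $A_s^{(p)}$ be the operator from functions on $\mathbb R_+$ to functions on $\mathbb R$ with kernel $A^{(p)}(t+y+s)$, $t\in\mathbb R$, $y\in\mathbb R_+$, put $A_s=A_s^{(0)}$, and assume that $\sqrt\sigma A_s$ and $\sqrt\sigma A_s^{(1)}$ are Hilbert–Schmidt for every $s$, i.e. $\int_{\mathbb R}\int_0^\infty\sigma(r)\,A^{(p)}(r+x+s)^2\,dx\,dr<\infty$ for $p=0,1$ (this holds automatically when $A$ and $A'$ grow at most polynomially at $-\infty$). Then for every $s\in\mathbb R$ the kernel $$K_2(x,y)=\int_{\mathbb R}A(r+x+s)\,\sigma(r)\,A(r+y+s)\,dr,\qquad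 x,y\ge 0,$$ is given by an absolutely convergent integral and defines a bounded operator $K_2=A_s^{\intercal}\sigma A_s$ on $L^2(\mathbb R_+)$, and $K_2(\cdot,0)$ and all $A^{(p)}(t+\cdot+s)$ lie in $L^2(\mathbb R_+)$. Whenever $I-K_2$ is invertible, define for $p\in\mathbb N$ and $t,t'\in\mathbb R$ the vector-valued function $q_p=A_s^{(p)}(I-K_2)^{-1}|\delta\rangle$ and the matrix-valued function $u_p=A_s^{(p)}(I-K_2)^{-1}A_s^{\intercal}$, where $\delta$ is the Dirac mass at $0$; that is, $$q_p(t)=A^{(p)}(t+s)+\big\langle A^{(p)}(t+\cdot+s),\,(I-K_2)^{-1}K_2(\cdot,0)\big\rangle_{L^2(\mathbb R_+)},$$ $$u_p(t,t')=\big\langle A^{(p)}(t+\cdot+s),\,(I-K_2)^{-1}A(t'+\cdot+s)\big\rangle_{L^2(\mathbb R_+)}.$$ Then, at every $s$ for which $I-K_2$ is invertible, and for all $p\in\mathbb N$ and $t,t'\in\mathbb R$, the functions $q_p(t)$ and $u_p(t,t')$ are differentiable in $s$, $u_p(t,\cdot)\,q_0$ is integrable with respect to $\sigma'$, and $$q_p'=q_{p+1}-u_p\,\sigma'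 q_0,\qquad u_p'=-q_p\,q_0^{\intercal},$$ that is, $$\partial_s q_p(t)=q_{p+1}(t)-\int_{\mathbb R}u_p(t,v)\,q_0(v)\,d\sigma(v),\qquad \partial_s u_p(t,t')=-q_p(t)\,q_0(t').$$ -/

import Mathlib

open MeasureTheory Filter Asymptotics
open scoped ContDiff

noncomputable section

namespace InhomHierarchy

/-- Lebesgue measure on the half-line `ℝ₊`. -/
def halfLine : Measure ℝ := volume.restrict (Set.Ioi 0)

/-- The real Hilbert space `L²(ℝ₊)`. -/
abbrev L2Half : Type := Lp ℝ 2 halfLine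

/-- The function `A` is smooth, and it vanishes exponentially fast at `+∞` together with each of
its derivatives. -/
structure IsProfile (A : ℝ → ℝ) : Prop where
  smooth : ContDiff ℝ ∞ A
  decay : ∀ p : ℕ, ∃ c > 0, iteratedDeriv p A =O[atTop] fun x => Real.exp (-(c * x))

/-- The function `σ` is increasing, smooth off a finite set (at whose points it has jumps, which
are bounded by monotonicity), and tends exponentially fast to `0` at `-∞` and to `γ ∈ (0, 1]` at
`+∞`. -/
structure IsWeight (σ : ℝ → ℝ) (γ : ℝ) : Prop where
  mono : Monotone σ
  piecewise_smooth : ∃ S : Finset ℝ, ContDiffOn ℝ ∞ σ (S : Set ℝ)ᶜ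
  pos : 0 < γ
  le_one : γ ≤ 1
  atBot : ∃ c > 0, σ =O[atBot] fun t => Real.exp (c * t)
  atTop : ∃ c > 0, (fun t => σ t - γ) =O[atTop] fun t => Real.exp (-(c * t))

/-- The operator `√σ A_s^{(p)} : L²(ℝ₊) → L²(ℝ)`, with kernel `√σ(r) A^{(p)}(r + x + s)`, is
Hilbert-Schmidt, that is, its kernel is square integrable. -/
def IsHilbertSchmidt (A σ : ℝ → ℝ) (p : ℕ) (s : ℝ) : Prop :=
  Integrable (fun z : ℝ × ℝ => σ z.1 * iteratedDeriv p A (z.1 + z.2 + s) ^ 2)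
    (volume.prod halfLine)

/-- The measure `σ'`, i.e. the distributional derivative (Stieltjes measure) of `σ`. -/
def dWeight {σ : ℝ → ℝ} (hσ : Monotone σ) : Measure ℝ := hσ.stieltjesFunction.measure

/-- The kernel of `K₂ = A_sᵀ σ A_s`:
`K₂(x, y) = ∫_ℝ A(r + x + s) σ(r) A(r + y + s) dr`. -/
def kernelK (A σ : ℝ → ℝ) (s x y : ℝ) : ℝ :=
  ∫ r : ℝ, A (r + x + s) * σ r * A (r + y + s)

/-- `T` is the integral operator on `L²(ℝ₊)` with kernel `k`. There is at most one such `T`. -/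
def IsIntegralOperator (k : ℝ → ℝ → ℝ) (T : L2Half →L[ℝ] L2Half) : Prop :=
  ∀ f : L2Half, ∀ᵐ x ∂halfLine,
    Integrable (fun y => k x y * f y) halfLine ∧ T f x = ∫ y, k x y * f y ∂halfLine

open Classical in
/-- The bounded operator `K₂` on `L²(ℝ₊)` with kernel `kernelK A σ s`
(and `0` if this kernel does not define a bounded operator). -/
def opK (A σ : ℝ → ℝ) (s : ℝ) : L2Half →L[ℝ] L2Half :=
  if h : ∃ T : L2Half →L[ℝ] L2Half, IsIntegralOperator (kernelK A σ s) T then h.choose else 0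

/-- The operator `(I - K₂)⁻¹` (meaningful when `I - K₂` is invertible). -/
def resolvent (A σ : ℝ → ℝ) (s : ℝ) : L2Half →L[ℝ] L2Half :=
  Ring.inverse (1 - opK A σ s)

open Classical in
/-- The class in `L²(ℝ₊)` of a square integrable function (and `0` otherwise). -/
def toL2 (f : ℝ → ℝ) : L2Half :=
  if h : MemLp f 2 halfLine then h.toLp f else 0

/-- The row `⟨t| A_s^{(p)}` of the operator `A_s^{(p)}` with kernel `A^{(p)}(t + y + s)`, as an
element of `L²(ℝ₊)`. For `p = 0` it is also the column `A_sᵀ |t⟩`. -/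
def row (A : ℝ → ℝ) (p : ℕ) (s t : ℝ) : L2Half :=
  toL2 fun y => iteratedDeriv p A (t + y + s)

/-- `q_p(t) = ⟨t| A_s^{(p)} (I - K₂)⁻¹ |δ⟩`. As `(I - K₂)⁻¹ |δ⟩ = |δ⟩ + (I - K₂)⁻¹ K₂ |δ⟩`, where
`K₂ |δ⟩` is the function `K₂(·, 0)` of `L²(ℝ₊)`, this reads
`q_p(t) = A^{(p)}(t + s) + ⟨A^{(p)}(t + · + s), (I - K₂)⁻¹ K₂(·, 0)⟩`. -/
def q (A σ : ℝ → ℝ) (p : ℕ) (s t : ℝ) : ℝ :=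
  iteratedDeriv p A (t + s) +
    inner ℝ (row A p s t) (resolvent A σ s (toL2 fun x => kernelK A σ s x 0))

/-- `u_p(t, t') = ⟨t| A_s^{(p)} (I - K₂)⁻¹ A_sᵀ |t'⟩`. -/
def u (A σ : ℝ → ℝ) (p : ℕ) (s t t' : ℝ) : ℝ :=
  inner ℝ (row A p s t) (resolvent A σ s (row A 0 s t'))

/-- The objects that enter `q_p` and `u_p` are given by convergent integrals and by square
integrable functions, and `K₂` is a bounded operator. -/
structure WellDefined (A σ : ℝ → ℝ) (s : ℝ) : Prop where
  kernel : ∀ x ≥ 0, ∀ y ≥ 0, Integrable fun r : ℝ => A (r + x + s) * σ r * A (r + y + s)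
  operator : IsIntegralOperator (kernelK A σ s) (opK A σ s)
  column : MemLp (fun x => kernelK A σ s x 0) 2 halfLine
  row : ∀ (p : ℕ) (t : ℝ), MemLp (fun y => iteratedDeriv p A (t + y + s)) 2 halfLine

end InhomHierarchy

end

/-! Write `φ_w` for `A(w + ·)` in `L²(ℝ₊)`, and let primes on `φ_w` stand for derivatives in `w`.
The curve `w ↦ φ_w` is smooth in norm, and shifting `s` moves along it. As Bochner integrals, `K =
K₂` is `∫ σ(r) |φ_{r+s}⟩⟨φ_{r+s}| dr` and `k = K₂(·, 0)` is `∫ σ(r) A(r+s) φ_{r+s} dr`. With `R = (I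
- K)⁻¹` one has `R' = R K' R`, so everything rests on two expressions for `K'`.

Moving the derivative onto `σ` gives `K' = -∫ |φ_{v+s}⟩⟨φ_{v+s}| dσ(v)` and likewise `k' = -∫ A(v+s)
φ_{v+s} dσ(v)`. Hence `(R k)' = R (K' R k + k') = -∫ q_0(v) R φ_{v+s} dσ(v)`. Pairing with the row
gives the integral term of `q_p'`, and differentiating the row gives `q_{p+1}`.

Differentiating the translates instead gives `K' = ∫ σ (|φ⟩⟨φ'| + |φ'⟩⟨φ|)`. Put `g = R φ_{t'+s}`
and let `d` be its derivative in `x`. By parts on the half-line, `⟨A^{(p+1)}(w+·), g⟩ +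
⟨A^{(p)}(w+·), d⟩ = -A^{(p)}(w) g(0)`, where `g(0) = q_0(t')` by self-adjointness of `R`. The case
`p = 0` inside `K' g` yields `K' g + φ'_{t'+s} = (I - K) d - q_0(t') k`. Applying `R` and using the
identity for general `p` leaves only `-q_p q_0`.

Domination comes from the decreasing function `envelope A w = ‖φ_w‖ + ‖φ'_w‖`. It bounds `|A w|`,
and the Hilbert–Schmidt hypotheses make its square integrable against both `σ(r) dr` and `dσ`. -/

noncomputable section

namespace InhomHierarchy

open Set Topology

/-! ### Translates of `A` as a smooth curve in `L²(ℝ₊)`. -/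

section Profile

variable {A : ℝ → ℝ} (hA : IsProfile A)
include hA

theorem IsProfile.continuous_iteratedDeriv (p : ℕ) : Continuous (iteratedDeriv p A) :=
  hA.smooth.continuous_iteratedDeriv p (by exact_mod_cast le_top)

theorem IsProfile.hasDerivAt_iteratedDeriv (p : ℕ) (x : ℝ) :
    HasDerivAt (iteratedDeriv p A) (iteratedDeriv (p + 1) A x) x := by
  rw [iteratedDeriv_succ]
  exact ((hA.smooth.differentiable_iteratedDeriv p (by exact_mod_cast WithTop.coe_lt_top _)) x).hasDerivAt

/-- The decay is only asymptotic; on the remaining compact interval continuity bounds the function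
times `exp (c * x)`. -/
theorem IsProfile.exists_exp_bound (p : ℕ) (a : ℝ) :
    ∃ C ≥ 0, ∃ c > 0, ∀ x ≥ a, |iteratedDeriv p A x| ≤ C * Real.exp (-c * x) := by
  obtain ⟨c, hc, h⟩ := hA.decay p
  obtain ⟨C, hC⟩ := h.bound
  obtain ⟨b, hb⟩ := eventually_atTop.1 hC
  obtain ⟨D, hD⟩ := (isCompact_Icc (a := a) (b := b)).exists_bound_of_continuousOn
    (f := fun x => iteratedDeriv p A x * Real.exp (c * x))
    (((hA.continuous_iteratedDeriv p).mul (by fun_prop)).continuousOn)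
  refine ⟨max (max C D) 0, le_max_right _ _, c, hc, fun x hx => ?_⟩
  rcases le_total b x with hbx | hbx
  · have := hb x hbx
    rw [Real.norm_eq_abs, Real.norm_eq_abs, Real.abs_exp] at this
    refine this.trans ?_
    rw [neg_mul]
    gcongr
    exact (le_max_left _ _).trans (le_max_left _ _)
  · have := hD x ⟨hx, hbx⟩
    rw [Real.norm_eq_abs, abs_mul, Real.abs_exp] at this
    have h1 : |iteratedDeriv p A x| ≤ D * Real.exp (-c * x) := by
      calc |iteratedDeriv p A x|
          = |iteratedDeriv p A x| * Real.exp (c * x) * Real.exp (-c * x) := by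
            rw [mul_assoc, ← Real.exp_add]; simp
        _ ≤ _ := by gcongr
    refine h1.trans ?_
    gcongr
    exact (le_max_right _ _).trans (le_max_left _ _)

omit hA in
theorem integrable_mul_of_abs_le_exp {f g : ℝ → ℝ} {C D c d : ℝ} (hC : 0 ≤ C)
    (hc : 0 < c) (hd : 0 < d) (hf : Continuous f) (hg : Continuous g)
    (hfC : ∀ x > 0, |f x| ≤ C * Real.exp (-c * x)) (hgD : ∀ x > 0, |g x| ≤ D * Real.exp (-d * x)) :
    IntegrableOn (fun x => f x * g x) (Ioi 0) := by
  refine Integrable.mono' ((exp_neg_integrableOn_Ioi 0 (add_pos hc hd)).const_mul (C * D))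
    (hf.mul hg).aestronglyMeasurable ?_
  filter_upwards [ae_restrict_mem measurableSet_Ioi] with x hx
  rw [Real.norm_eq_abs, abs_mul]
  calc |f x| * |g x| ≤ (C * Real.exp (-c * x)) * (D * Real.exp (-d * x)) :=
        mul_le_mul (hfC x hx) (hgD x hx) (abs_nonneg _) (by positivity)
    _ = C * D * Real.exp (-(c + d) * x) := by
        rw [show -(c + d) * x = -c * x + -d * x by ring, Real.exp_add]; ring

theorem IsProfile.exists_exp_bound_translate (p : ℕ) (w : ℝ) :
    ∃ C ≥ 0, ∃ c > 0, ∀ x > 0, ∀ h, |h| ≤ 1 →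
      |iteratedDeriv p A (w + h + x)| ≤ C * Real.exp (-c * x) := by
  obtain ⟨C, hC, c, hc, h⟩ := hA.exists_exp_bound p (w - 1)
  refine ⟨C * Real.exp (-c * (w - 1)), by positivity, c, hc, fun x hx t ht => ?_⟩
  have := (abs_le.1 ht).1
  refine (h _ (by linarith)).trans ?_
  rw [mul_assoc, ← Real.exp_add]
  gcongr
  nlinarith

theorem IsProfile.integrable_mul (p p' : ℕ) (w w' : ℝ) :
    IntegrableOn (fun x => iteratedDeriv p A (w + x) * iteratedDeriv p' A (w' + x)) (Ioi 0) := by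
  obtain ⟨C, hC, c, hc, h⟩ := hA.exists_exp_bound_translate p w
  obtain ⟨D, hD, d, hd, h'⟩ := hA.exists_exp_bound_translate p' w'
  refine integrable_mul_of_abs_le_exp (D := D) hC hc hd
    ((hA.continuous_iteratedDeriv p).comp (by fun_prop))
    ((hA.continuous_iteratedDeriv p').comp (by fun_prop)) (fun x hx => ?_) (fun x hx => ?_)
  · simpa using h x hx 0 (by simp)
  · simpa using h' x hx 0 (by simp)

theorem IsProfile.memLp (p : ℕ) (w : ℝ) :
    MemLp (fun y => iteratedDeriv p A (w + y)) 2 halfLine := by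
  have hc : Continuous fun y => iteratedDeriv p A (w + y) :=
    (hA.continuous_iteratedDeriv p).comp (by fun_prop)
  rw [memLp_two_iff_integrable_sq hc.aestronglyMeasurable]
  simpa only [sq] using! hA.integrable_mul p p w w

omit hA in
/-- The function `x ↦ A^{(p)}(w + x)` as an element of `L²(ℝ₊)`. -/
def translate (A : ℝ → ℝ) (p : ℕ) (w : ℝ) : L2Half :=
  toL2 fun y => iteratedDeriv p A (w + y)

omit hA in
theorem row_eq_translate (p : ℕ) (s t : ℝ) : row A p s t = translate A p (t + s) := by
  unfold row translate
  congr 1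
  ext y
  ring_nf

omit hA in
theorem toL2_coeFn {f : ℝ → ℝ} (hf : MemLp f 2 halfLine) : toL2 f =ᵐ[halfLine] f := by
  rw [toL2, dif_pos hf]
  exact hf.coeFn_toLp

theorem translate_coeFn (p : ℕ) (w : ℝ) :
    translate A p w =ᵐ[halfLine] fun y => iteratedDeriv p A (w + y) :=
  toL2_coeFn (hA.memLp p w)

theorem inner_translate (p : ℕ) (w : ℝ) (f : L2Half) :
    inner ℝ (translate A p w) f = ∫ x, iteratedDeriv p A (w + x) * f x ∂halfLine := by
  rw [L2.inner_def]
  refine integral_congr_ae ?_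
  filter_upwards [translate_coeFn hA p w] with x hx
  simp [hx, mul_comm]

theorem inner_translate_translate (p p' : ℕ) (w w' : ℝ) :
    inner ℝ (translate A p w) (translate A p' w') =
      ∫ x in Ioi 0, iteratedDeriv p A (w + x) * iteratedDeriv p' A (w' + x) := by
  rw [inner_translate hA]
  refine integral_congr_ae ?_
  filter_upwards [translate_coeFn hA p' w'] with x hx
  simp [hx]

/-- As a tail integral the norm is visibly decreasing in `w`, and integration by parts against `dσ`
applies to it. -/
theorem norm_translate_sq (p : ℕ) (w : ℝ) :
    ‖translate A p w‖ ^ 2 = ∫ x in Ioi w, iteratedDeriv p A x ^ 2 := by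
  rw [← real_inner_self_eq_norm_sq, inner_translate_translate hA,
    ← (measurePreserving_add_left volume w).setIntegral_preimage_emb
      (measurableEmbedding_addLeft w) (fun x => iteratedDeriv p A x ^ 2) (Ioi w)]
  simp [sq]

theorem IsProfile.integrableOn_sq (p : ℕ) (w : ℝ) :
    IntegrableOn (fun x => iteratedDeriv p A x ^ 2) (Ioi w) := by
  rw [← (measurePreserving_add_left volume w).integrableOn_comp_preimage
    (measurableEmbedding_addLeft w)]
  simpa [sq, Function.comp_def] using hA.integrable_mul p p w w

theorem antitone_norm_translate (p : ℕ) : Antitone fun w => ‖translate A p w‖ := by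
  intro w w' h
  refine (pow_le_pow_iff_left₀ (norm_nonneg _) (norm_nonneg _) two_ne_zero).1 ?_
  rw [norm_translate_sq hA, norm_translate_sq hA]
  exact setIntegral_mono_set (hA.integrableOn_sq p w) (ae_of_all _ fun x => sq_nonneg _)
    (Ioi_subset_Ioi h).eventuallyLE

/-- The first-order Taylor remainder is at most `C * exp (-c * x) * h ^ 2` for `|h| ≤ 1`, by the
exponential bound on the derivative of order `p + 2`; this majorant lies in `L²(ℝ₊)`. -/
theorem hasDerivAt_translate (p : ℕ) (w : ℝ) :
    HasDerivAt (translate A p) (translate A (p + 1) w) w := by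
  obtain ⟨C, hC, c, hc, hb⟩ := hA.exists_exp_bound_translate (p + 2) w
  have hE : MemLp (fun x => C * Real.exp (-c * x)) 2 halfLine := by
    rw [memLp_two_iff_integrable_sq (by fun_prop)]
    have hcont : Continuous fun x => C * Real.exp (-c * x) := by fun_prop
    simpa only [sq] using! integrable_mul_of_abs_le_exp hC hc hc hcont hcont
      (fun x _ => (abs_of_nonneg (by positivity)).le) (fun x _ => (abs_of_nonneg (by positivity)).le)
  rw [hasDerivAt_iff_isLittleO_nhds_zero]
  refine IsBigO.trans_isLittleO (g := fun h : ℝ => h ^ 2) ?_ (isLittleO_pow_id (by norm_num))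
  refine IsBigO.of_bound ‖toL2 fun x => C * Real.exp (-c * x)‖ ?_
  filter_upwards [Metric.closedBall_mem_nhds (0 : ℝ) one_pos] with h hh
  rw [mem_closedBall_zero_iff, Real.norm_eq_abs] at hh
  rw [mul_comm, norm_pow, Real.norm_eq_abs]
  refine Lp.norm_le_mul_norm_of_ae_le_mul ?_
  have h1 := Lp.coeFn_sub (translate A p (w + h) - translate A p w) (h • translate A (p + 1) w)
  have h2 := Lp.coeFn_sub (translate A p (w + h)) (translate A p w)
  have h3 := Lp.coeFn_smul h (translate A (p + 1) w)
  filter_upwards [h1, h2, h3, translate_coeFn hA p (w + h), translate_coeFn hA p w,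
    translate_coeFn hA (p + 1) w, toL2_coeFn hE, ae_restrict_mem measurableSet_Ioi]
    with x h1 h2 h3 h4 h5 h6 h7 hx
  rw [h1, Pi.sub_apply, h2, Pi.sub_apply, h3, Pi.smul_apply, h4, h5, h6, h7, smul_eq_mul]
  rw [Real.norm_eq_abs (C * _), abs_of_nonneg (a := C * _) (by positivity)]
  have hmem : ∀ {t}, t ∈ uIcc 0 h → |t| ≤ |h| := fun ht => by
    simpa using abs_sub_left_of_mem_uIcc ht
  have key1 : ∀ t ∈ uIcc 0 h,
      ‖iteratedDeriv (p + 1) A (w + t + x) - iteratedDeriv (p + 1) A (w + x)‖ ≤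
        C * Real.exp (-c * x) * |h| := by
    intro t ht
    have := Convex.norm_image_sub_le_of_norm_hasDerivWithin_le (s := uIcc 0 h) (x := 0) (y := t)
      (f := fun t => iteratedDeriv (p + 1) A (w + t + x)) (C := C * Real.exp (-c * x))
      (f' := fun t => iteratedDeriv (p + 2) A (w + t + x))
      (fun r _ => by
        have := (hA.hasDerivAt_iteratedDeriv (p + 1) (w + r + x)).comp_add_const (w + r) x
        have := HasDerivAt.comp_const_add w r this
        exact this.hasDerivWithinAt)
      (fun r hr => hb x hx r ((hmem hr).trans hh)) (convex_uIcc 0 h) left_mem_uIcc ht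
    simp only [add_zero, sub_zero] at this
    refine this.trans ?_
    gcongr
    exact hmem ht
  -- Second use of the mean value inequality, now with the linear part subtracted: `key1` bounds the
  -- derivative of the difference.
  have := Convex.norm_image_sub_le_of_norm_hasDerivWithin_le (s := uIcc 0 h) (x := 0) (y := h)
      (f := fun t => iteratedDeriv p A (w + t + x) - t * iteratedDeriv (p + 1) A (w + x))
      (C := C * Real.exp (-c * x) * |h|)
      (f' := fun t => iteratedDeriv (p + 1) A (w + t + x) - iteratedDeriv (p + 1) A (w + x))
      (fun r _ => by
        have h1 := (hA.hasDerivAt_iteratedDeriv p (w + r + x)).comp_add_const (w + r) x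
        have h1 := HasDerivAt.comp_const_add w r h1
        have h2 := (hasDerivAt_id r).mul_const (iteratedDeriv (p + 1) A (w + x))
        rw [one_mul] at h2
        exact (h1.sub h2).hasDerivWithinAt)
      key1 (convex_uIcc 0 h) left_mem_uIcc right_mem_uIcc
  simp only [add_zero, sub_zero, zero_mul, Real.norm_eq_abs] at this
  calc _ = |iteratedDeriv p A (w + h + x) - h * iteratedDeriv (p + 1) A (w + x)
        - iteratedDeriv p A (w + x)| := by rw [Real.norm_eq_abs]; congr 1; ring
    _ ≤ _ := this
    _ = _ := by ring

theorem continuous_translate (p : ℕ) : Continuous (translate A p) :=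
  continuous_iff_continuousAt.2 fun w => (hasDerivAt_translate hA p w).continuousAt

/-- Integration by parts on the half-line. -/
theorem inner_translate_succ_add (p p' : ℕ) (w w' : ℝ) :
    inner ℝ (translate A (p + 1) w) (translate A p' w') +
      inner ℝ (translate A p w) (translate A (p' + 1) w') =
        -(iteratedDeriv p A w * iteratedDeriv p' A w') := by
  rw [inner_translate_translate hA, inner_translate_translate hA,
    ← integral_add (hA.integrable_mul _ _ _ _) (hA.integrable_mul _ _ _ _)]
  have hd : ∀ x, HasDerivAt (fun x => iteratedDeriv p A (w + x) * iteratedDeriv p' A (w' + x))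
      (iteratedDeriv (p + 1) A (w + x) * iteratedDeriv p' A (w' + x) +
        iteratedDeriv p A (w + x) * iteratedDeriv (p' + 1) A (w' + x)) x := fun x =>
    ((hA.hasDerivAt_iteratedDeriv p (w + x)).comp_const_add w x).mul
      ((hA.hasDerivAt_iteratedDeriv p' (w' + x)).comp_const_add w' x)
  have ht : ∀ (p : ℕ) (w : ℝ), Tendsto (fun x => iteratedDeriv p A (w + x)) atTop (𝓝 0) := by
    intro p w
    obtain ⟨c, hc, h⟩ := hA.decay p
    refine (h.trans_tendsto ?_).comp (tendsto_atTop_add_const_left _ _ tendsto_id)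
    exact Real.tendsto_exp_neg_atTop_nhds_zero.comp (tendsto_id.const_mul_atTop hc)
  rw [integral_Ioi_of_hasDerivAt_of_tendsto (hd 0).continuousAt.continuousWithinAt
    (fun x _ => hd x) ((hA.integrable_mul _ _ _ _).add (hA.integrable_mul _ _ _ _))
    (by simpa using (ht p w).mul (ht p' w'))]
  simp

omit hA in
/-- The sum of the norms of `A(w + ·)` and of its derivative in `L²(ℝ₊)`. -/
def envelope (A : ℝ → ℝ) (w : ℝ) : ℝ := ‖translate A 0 w‖ + ‖translate A 1 w‖

omit hA in
theorem envelope_nonneg (w : ℝ) : 0 ≤ envelope A w := by unfold envelope; positivity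

theorem antitone_envelope : Antitone (envelope A) :=
  (antitone_norm_translate hA 0).add (antitone_norm_translate hA 1)

theorem continuous_envelope : Continuous (envelope A) :=
  (continuous_translate hA 0).norm.add (continuous_translate hA 1).norm

/-- Integration by parts with `p = p' = 0` gives `A(w)² = -2⟨φ_w, φ'_w⟩`. This turns pointwise
values of `A` into `L²` quantities. -/
theorem abs_le_envelope (w : ℝ) : |A w| ≤ envelope A w := by
  have h := inner_translate_succ_add hA 0 0 w w
  have h1 := abs_real_inner_le_norm (translate A 0 w) (translate A 1 w)
  rw [zero_add, real_inner_comm (translate A 0 w), iteratedDeriv_zero] at h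
  refine abs_le_of_sq_le_sq ?_ (envelope_nonneg w)
  have := neg_abs_le (inner ℝ (translate A 0 w) (translate A 1 w))
  unfold envelope
  nlinarith [sq_nonneg ‖translate A 0 w‖, sq_nonneg ‖translate A 1 w‖]

omit hA in
theorem norm_translate_zero_le (w : ℝ) : ‖translate A 0 w‖ ≤ envelope A w :=
  le_add_of_nonneg_right (norm_nonneg _)

omit hA in
theorem norm_translate_one_le (w : ℝ) : ‖translate A 1 w‖ ≤ envelope A w :=
  le_add_of_nonneg_left (norm_nonneg _)

end Profile

/-! ### Integration by parts against the Stieltjes measure of `σ`. -/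

section Weight

variable {σ : ℝ → ℝ} {γ : ℝ} (hσ : IsWeight σ γ)
include hσ

theorem IsWeight.tendsto_atBot : Tendsto σ Filter.atBot (𝓝 0) := by
  obtain ⟨c, hc, h⟩ := hσ.atBot
  exact h.trans_tendsto (Real.tendsto_exp_atBot.comp (tendsto_id.const_mul_atBot hc))

theorem IsWeight.tendsto_atTop : Tendsto σ Filter.atTop (𝓝 γ) := by
  obtain ⟨c, hc, h⟩ := hσ.atTop
  have := h.trans_tendsto
    (Real.tendsto_exp_neg_atTop_nhds_zero.comp (tendsto_id.const_mul_atTop hc))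
  simpa using this.add_const γ

theorem IsWeight.nonneg (x : ℝ) : 0 ≤ σ x :=
  hσ.mono.le_of_tendsto hσ.tendsto_atBot x

theorem IsWeight.measurable : Measurable σ := hσ.mono.measurable

instance : SigmaFinite halfLine := by
  unfold halfLine; infer_instance

instance {f : ℝ → ℝ} (hf : Monotone f) : SigmaFinite (dWeight hf) := by
  unfold dWeight; infer_instance

theorem IsWeight.dWeight_Iic (x : ℝ) :
    dWeight hσ.mono (Iic x) = ENNReal.ofReal (Function.rightLim σ x) := by
  have h : Tendsto hσ.mono.stieltjesFunction Filter.atBot (𝓝 0) := by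
    refine tendsto_of_tendsto_of_tendsto_of_le_of_le hσ.tendsto_atBot
      (hσ.tendsto_atBot.comp (tendsto_atBot_add_const_right _ (1 : ℝ) tendsto_id)) ?_ ?_
    · intro x
      rw [hσ.mono.stieltjesFunction_eq]
      exact hσ.mono.le_rightLim le_rfl
    · intro x
      rw [hσ.mono.stieltjesFunction_eq]
      exact hσ.mono.rightLim_le (by simp)
  rw [dWeight, StieltjesFunction.measure_Iic _ h, hσ.mono.stieltjesFunction_eq, sub_zero]

/-- The right limit differs from `σ` only at jumps, which are countably many and so Lebesgue-null.
-/
theorem IsWeight.ae_dWeight_Iic :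
    ∀ᵐ x : ℝ, (dWeight hσ.mono).real (Iic x) = σ x := by
  filter_upwards [hσ.mono.countable_not_continuousAt.ae_notMem volume] with x hx
  rw [not_not] at hx
  have h : Function.rightLim σ x = σ x := hx.continuousWithinAt.rightLim_eq
  rw [Measure.real, hσ.dWeight_Iic, h, ENNReal.toReal_ofReal (hσ.nonneg x)]

variable {E : Type*} [NormedAddCommGroup E] [NormedSpace ℝ E]

omit hσ [NormedSpace ℝ E] in
theorem indicator_Ici_eq_indicator_Iic (F : ℝ → E) (v w : ℝ) :
    (Ici v).indicator F w = (Iic w).indicator (fun _ => F w) v := by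
  simp [indicator]

/-- Tonelli: for fixed `w`, integrating `‖F w‖` over `v ≤ w` against `dσ` gives `σ w * ‖F w‖`. -/
theorem IsWeight.integrable_indicator {F : ℝ → E} (hF : StronglyMeasurable F)
    (hint : Integrable fun w => σ w • F w) :
    Integrable (fun z : ℝ × ℝ => (Ici z.1).indicator F z.2) ((dWeight hσ.mono).prod volume) := by
  have hmeas : AEStronglyMeasurable (fun z : ℝ × ℝ => (Ici z.1).indicator F z.2)
      ((dWeight hσ.mono).prod volume) :=
    ((hF.comp_measurable measurable_snd).indicator
      (measurableSet_le measurable_fst measurable_snd)).aestronglyMeasurable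
  rw [integrable_prod_iff' hmeas]
  simp only [indicator_Ici_eq_indicator_Iic]
  refine ⟨ae_of_all _ fun w => (integrable_indicator_iff measurableSet_Iic).2
    (integrableOn_const (by rw [hσ.dWeight_Iic]; exact ENNReal.ofReal_ne_top)), ?_⟩
  refine hint.norm.congr ?_
  filter_upwards [hσ.ae_dWeight_Iic] with w hw
  simp_rw [norm_indicator_eq_indicator_norm]
  rw [integral_indicator measurableSet_Iic, setIntegral_const, hw, norm_smul,
    Real.norm_of_nonneg (hσ.nonneg w), smul_eq_mul]

theorem IsWeight.integrable_integral_Ioi {F : ℝ → E} (hF : StronglyMeasurable F)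
    (hint : Integrable fun w => σ w • F w) :
    Integrable (fun v => ∫ w in Ioi v, F w) (dWeight hσ.mono) := by
  refine (hσ.integrable_indicator hF hint).integral_prod_left.congr (ae_of_all _ fun v => ?_)
  simp only
  rw [integral_indicator measurableSet_Ici, integral_Ici_eq_integral_Ioi]

/-- Integration by parts against the Stieltjes measure. -/
theorem IsWeight.integral_integral_Ioi [CompleteSpace E] {F : ℝ → E} (hF : StronglyMeasurable F)
    (hint : Integrable fun w => σ w • F w) :
    ∫ v, (∫ w in Ioi v, F w) ∂(dWeight hσ.mono) = ∫ w, σ w • F w := by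
  have h := hσ.integrable_indicator hF hint
  have h1 := integral_integral_swap (f := fun v w => (Ici v).indicator F w) h
  calc _ = ∫ v, (∫ w, (Ici v).indicator F w) ∂(dWeight hσ.mono) := by
        congr 1; ext v
        rw [integral_indicator measurableSet_Ici, integral_Ici_eq_integral_Ioi]
    _ = _ := by
        rw [h1]
        refine integral_congr_ae ?_
        filter_upwards [hσ.ae_dWeight_Iic] with w hw
        simp only [indicator_Ici_eq_indicator_Iic]
        rw [integral_indicator measurableSet_Iic, setIntegral_const, hw]

omit hσ in
theorem hasDerivAt_integral_Ioi [CompleteSpace E] {F : ℝ → E} (hF : Continuous F)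
    (hint : ∀ x, IntegrableOn F (Ioi x)) (x : ℝ) :
    HasDerivAt (fun y => ∫ w in Ioi y, F w) (-F x) x := by
  have h : (fun y => ∫ w in Ioi y, F w) = fun y => (∫ w in Ioi x, F w) - ∫ w in x..y, F w := by
    ext y
    rw [← intervalIntegral.integral_interval_add_Ioi (hint x) (hint y)]
    simp
  rw [h]
  exact (hF.integral_hasStrictDerivAt x x).hasDerivAt.const_sub _

/-- Since `γ > 0`, eventually `σ > γ / 2`, so the weight can be divided out near `+∞`; a bounded
interval remains. -/
theorem IsWeight.integrableOn_Ioi {F : ℝ → E} (hF : Continuous F)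
    (hint : Integrable fun w => σ w • F w) (x : ℝ) : IntegrableOn F (Ioi x) := by
  obtain ⟨b, hb⟩ := (eventually_atTop (α := ℝ)).1
    (hσ.tendsto_atTop.eventually_const_lt (half_lt_self hσ.pos))
  have h1 : IntegrableOn F (Ioi (max b x)) := by
    refine Integrable.mono' (hint.norm.const_mul (2 / γ)).integrableOn hF.aestronglyMeasurable ?_
    filter_upwards [ae_restrict_mem measurableSet_Ioi] with w hw
    have := hb w ((le_max_left _ _).trans hw.le)
    rw [norm_smul, Real.norm_of_nonneg (hσ.nonneg w)]
    have h2 : 1 ≤ 2 / γ * σ w := by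
      rw [div_mul_eq_mul_div, one_le_div hσ.pos]; linarith
    nlinarith [norm_nonneg (F w)]
  rw [← Ioc_union_Ioi_eq_Ioi (le_max_right b x)]
  exact (hF.integrableOn_Icc.mono_set Ioc_subset_Icc_self).union h1

/-- The derivative of `∫ σ(r) F(r + s) dr` in `s` is minus the integral of `F(· + s)` against the
Stieltjes measure of `σ`. -/
theorem IsWeight.hasDerivAt_integral_smul [CompleteSpace E] {F : ℝ → E} {M : ℝ → ℝ}
    (hF : Continuous F) (hFM : ∀ w, ‖F w‖ ≤ M w) (hM : Antitone M)
    (hMσ : ∀ s, Integrable fun r => σ r * M (r + s))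
    (hMd : ∀ s, Integrable (fun v => M (v + s)) (dWeight hσ.mono)) (s : ℝ) :
    HasDerivAt (fun s => ∫ r, σ r • F (r + s)) (-∫ v, F (v + s) ∂(dWeight hσ.mono)) s := by
  have hFσ : ∀ s, Integrable fun r => σ r • F (r + s) := fun s => by
    refine Integrable.mono' (hMσ s) (hσ.measurable.aestronglyMeasurable.smul
      (hF.comp (continuous_add_const s)).aestronglyMeasurable) (ae_of_all _ fun r => ?_)
    rw [norm_smul, Real.norm_of_nonneg (hσ.nonneg r)]
    exact mul_le_mul_of_nonneg_left (hFM _) (hσ.nonneg r)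
  have hFs : ∀ s, Continuous fun r => F (r + s) := fun s => hF.comp (continuous_add_const s)
  have hIoi : ∀ x, IntegrableOn F (Ioi x) := hσ.integrableOn_Ioi hF (by simpa using hFσ 0)
  have hshift : ∀ s v, ∫ w in Ioi v, F (w + s) = ∫ w in Ioi (v + s), F w := fun s v => by
    rw [← (measurePreserving_add_right volume s).setIntegral_preimage_emb
      (measurableEmbedding_addRight s) F (Ioi (v + s))]
    simp
  -- The parameter now enters only through the lower limit of a tail integral, so continuity of `F`
  -- suffices.
  have hG : (fun s => ∫ r, σ r • F (r + s)) =
      fun s => ∫ v, (∫ w in Ioi (v + s), F w) ∂(dWeight hσ.mono) := by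
    ext s
    rw [← hσ.integral_integral_Ioi (hFs s).stronglyMeasurable (hFσ s)]
    simp only [hshift]
  rw [hG, ← integral_neg]
  have hd := hasDerivAt_integral_Ioi hF hIoi
  have hcont : Continuous fun x => ∫ w in Ioi x, F w :=
    continuous_iff_continuousAt.2 fun x => (hd x).continuousAt
  -- As `M` is decreasing, its value at `v + (s - 1)` dominates for every parameter above `s - 1`.
  refine (hasDerivAt_integral_of_dominated_loc_of_deriv_le
    (F' := fun s v => -F (v + s)) (bound := fun v => M (v + (s - 1)))
    (Ioi_mem_nhds (sub_one_lt s)) (Eventually.of_forall fun s' => ?_) ?_ ?_ ?_ (hMd _) ?_).2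
  · exact (hcont.comp (continuous_add_const s')).aestronglyMeasurable
  · have := hσ.integrable_integral_Ioi (hFs s).stronglyMeasurable (hFσ s)
    simpa only [hshift] using this
  · exact (hFs s).neg.aestronglyMeasurable
  · refine ae_of_all _ fun v x hx => ?_
    rw [norm_neg]
    exact (hFM _).trans (hM (by have := mem_Ioi.1 hx; linarith))
  · exact ae_of_all _ fun v x _ => (hd (v + x)).comp_const_add v x

end Weight

/-! ### Integrability consequences of the Hilbert–Schmidt hypotheses. -/

section HilbertSchmidt

variable {A σ : ℝ → ℝ} {γ : ℝ} (hA : IsProfile A) (hσ : IsWeight σ γ)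

include hA in
theorem IsHilbertSchmidt.integrable_norm_sq {p : ℕ} {s : ℝ} (h : IsHilbertSchmidt A σ p s) :
    Integrable fun r => σ r * ‖translate A p (r + s)‖ ^ 2 := by
  refine h.integral_prod_left.congr (ae_of_all _ fun r => ?_)
  simp only
  rw [integral_const_mul, ← real_inner_self_eq_norm_sq, inner_translate_translate hA, halfLine]
  congr 2
  ext x
  ring_nf

-- Fubini at parameter `s - 1` gives integrability on almost every slice `x > 0`. Taking `x < 1` and
-- shifting by `1 - x > 0` recovers the argument `w + s` with weight `σ (w + (1 - x)) ≥ σ w`.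
include hA hσ in
theorem IsHilbertSchmidt.integrable_sq {p : ℕ} (h : ∀ s, IsHilbertSchmidt A σ p s) (s : ℝ) :
    Integrable fun w => σ w * iteratedDeriv p A (w + s) ^ 2 := by
  have h1 : ∀ᵐ x ∂volume.restrict (Ioi (0 : ℝ)), x ∈ Ioi (0 : ℝ) → x < 1 →
      Integrable fun w => σ w * iteratedDeriv p A (w + s) ^ 2 := by
    filter_upwards [(h (s - 1)).prod_left_ae] with x hx _ hx1
    have h2 := hx.comp_add_right (1 - x)
    refine h2.mono' (hσ.measurable.aestronglyMeasurable.mul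
      (((hA.continuous_iteratedDeriv p).comp (continuous_add_const s)).pow 2).aestronglyMeasurable)
      (ae_of_all _ fun w => ?_)
    rw [Real.norm_of_nonneg (mul_nonneg (hσ.nonneg w) (sq_nonneg _)),
      show w + (1 - x) + x + (s - 1) = w + s by ring]
    exact mul_le_mul_of_nonneg_right (hσ.mono (by linarith)) (sq_nonneg _)
  have h3 : volume.restrict (Ioi (0 : ℝ)) (Ioo 0 1) ≠ 0 := by
    rw [Measure.restrict_apply measurableSet_Ioo, inter_eq_left.2 Ioo_subset_Ioi_self]
    simp
  obtain ⟨x, hx, hx'⟩ := (frequently_ae_mem_iff.2 h3).and_eventually h1 |>.exists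
  exact hx' hx.1 hx.2

include hA in
theorem IsHilbertSchmidt.integrable_dWeight {p : ℕ} (h : ∀ s, IsHilbertSchmidt A σ p s) (s : ℝ) :
    Integrable (fun v => ‖translate A p (v + s)‖ ^ 2) (dWeight hσ.mono) := by
  have hc : Continuous fun w => iteratedDeriv p A (w + s) ^ 2 :=
    ((hA.continuous_iteratedDeriv p).comp (continuous_add_const s)).pow 2
  refine (hσ.integrable_integral_Ioi hc.stronglyMeasurable
    (IsHilbertSchmidt.integrable_sq hA hσ h s)).congr (ae_of_all _ fun v => ?_)
  simp only
  rw [norm_translate_sq hA, ← (measurePreserving_add_right volume s).setIntegral_preimage_emb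
      (measurableEmbedding_addRight s) (fun x => iteratedDeriv p A x ^ 2) (Ioi (v + s))]
  simp

variable (hHS : ∀ p ≤ 1, ∀ s : ℝ, IsHilbertSchmidt A σ p s)
include hA hσ hHS

theorem integrable_mul_envelope_sq (s : ℝ) :
    Integrable fun r => σ r * envelope A (r + s) ^ 2 := by
  refine ((((hHS 0 zero_le_one s).integrable_norm_sq hA).add
    ((hHS 1 le_rfl s).integrable_norm_sq hA)).const_mul 2).mono'
    (hσ.measurable.aestronglyMeasurable.mul
      (((continuous_envelope hA).comp (continuous_add_const s)).pow 2).aestronglyMeasurable)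
    (ae_of_all _ fun r => ?_)
  rw [Real.norm_of_nonneg (mul_nonneg (hσ.nonneg r) (sq_nonneg _)), Pi.add_apply, ← mul_add,
    mul_left_comm]
  exact mul_le_mul_of_nonneg_left add_sq_le (hσ.nonneg r)

theorem integrable_envelope_sq_dWeight (s : ℝ) :
    Integrable (fun v => envelope A (v + s) ^ 2) (dWeight hσ.mono) := by
  refine ((IsHilbertSchmidt.integrable_dWeight hA hσ (hHS 0 zero_le_one) s).add
    (IsHilbertSchmidt.integrable_dWeight hA hσ (hHS 1 le_rfl) s)).const_mul 2 |>.mono'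
    ((((continuous_envelope hA).comp (continuous_add_const s)).pow 2).aestronglyMeasurable)
    (ae_of_all _ fun r => ?_)
  rw [Real.norm_of_nonneg (sq_nonneg _)]
  exact add_sq_le

omit hσ hHS in
theorem antitone_envelope_sq : Antitone fun w => envelope A w ^ 2 := fun _ _ h =>
  pow_le_pow_left₀ (envelope_nonneg _) (antitone_envelope hA h) 2

end HilbertSchmidt

/-! ### Pointwise values of `L²(ℝ₊)`-valued integrals. -/

theorem integrable_mul_L2Half (f g : L2Half) : Integrable (fun x => f x * g x) halfLine := by
  simpa [mul_comm] using L2.integrable_inner (𝕜 := ℝ) f g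

theorem integral_abs_mul_le (f g : L2Half) : ∫ x, |f x * g x| ∂halfLine ≤ ‖f‖ * ‖g‖ := by
  have h := real_inner_le_norm |f| |g|
  rw [norm_abs_eq_norm, norm_abs_eq_norm, L2.inner_def] at h
  refine le_trans (le_of_eq (integral_congr_ae ?_)) h
  filter_upwards [Lp.coeFn_abs f, Lp.coeFn_abs g] with x hf hg
  simp [hf, hg, abs_mul, mul_comm]

section

variable {A : ℝ → ℝ} (hA : IsProfile A) {c : ℝ → ℝ} (hc : Measurable c) {s : ℝ}
  (hint : Integrable fun r => c r * ‖translate A 0 (r + s)‖)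
include hA hc hint

theorem integrable_prod_translate (f : L2Half) :
    Integrable (fun z : ℝ × ℝ => c z.1 * A (z.1 + s + z.2) * f z.2) (volume.prod halfLine) := by
  have hcont : Continuous A := by simpa using hA.continuous_iteratedDeriv 0
  have hmeas : AEStronglyMeasurable (fun z : ℝ × ℝ => c z.1 * A (z.1 + s + z.2) * f z.2)
      (volume.prod halfLine) :=
    (((hc.comp measurable_fst).aestronglyMeasurable).mul
      (hcont.comp (by fun_prop : Continuous fun z : ℝ × ℝ => z.1 + s + z.2)).aestronglyMeasurable).mul
      (Lp.aestronglyMeasurable f).comp_snd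
  have hcongr : ∀ r, (fun x => c r * (translate A 0 (r + s) x * f x)) =ᵐ[halfLine]
      fun x => c r * A (r + s + x) * f x := fun r => by
    filter_upwards [translate_coeFn hA 0 (r + s)] with x hx
    rw [hx, iteratedDeriv_zero, mul_assoc]
  rw [integrable_prod_iff hmeas]
  refine ⟨ae_of_all _ fun r => ((integrable_mul_L2Half _ f).const_mul (c r)).congr (hcongr r), ?_⟩
  refine (hint.norm.mul_const ‖f‖).mono' hmeas.norm.integral_prod_right' (ae_of_all _ fun r => ?_)
  rw [Real.norm_of_nonneg (integral_nonneg fun _ => norm_nonneg _)]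
  calc _ = |c r| * ∫ x, |translate A 0 (r + s) x * f x| ∂halfLine := by
        rw [← integral_const_mul]
        refine integral_congr_ae ?_
        filter_upwards [hcongr r] with x hx
        rw [← hx, Real.norm_eq_abs, abs_mul]
    _ ≤ |c r| * (‖translate A 0 (r + s)‖ * ‖f‖) :=
        mul_le_mul_of_nonneg_left (integral_abs_mul_le _ _) (abs_nonneg _)
    _ = _ := by simp [mul_assoc]

theorem integrable_integral_mul_translate (f : L2Half) :
    Integrable (fun x => (∫ r, c r * A (r + s + x)) * f x) halfLine := by
  refine (integrable_prod_translate hA hc hint f).integral_prod_right.congr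
    (ae_of_all _ fun x => ?_)
  exact integral_mul_const (f x) _

theorem integral_mul_inner_translate (f : L2Half) :
    ∫ r, c r * inner ℝ (translate A 0 (r + s)) f =
      ∫ x, (∫ r, c r * A (r + s + x)) * f x ∂halfLine := by
  have h := integral_integral_swap
    (f := fun r x => c r * A (r + s + x) * f x) (integrable_prod_translate hA hc hint f)
  calc _ = ∫ r, ∫ x, c r * A (r + s + x) * f x ∂halfLine := by
        congr 1; ext r
        rw [inner_translate hA, ← integral_const_mul]
        simp [mul_assoc]
    _ = _ := by
        rw [h]
        congr 1; ext x
        exact integral_mul_const _ _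

theorem integrable_smul_translate : Integrable fun r => c r • translate A 0 (r + s) := by
  refine hint.norm.mono' (hc.aestronglyMeasurable.smul
    ((continuous_translate hA 0).comp (continuous_add_const s)).aestronglyMeasurable)
    (ae_of_all _ fun r => ?_)
  simp [norm_smul]

/-- The pointwise values of an `L²(ℝ₊)`-valued integral of translates of `A`. -/
theorem integral_smul_translate_coeFn :
    (∫ r, c r • translate A 0 (r + s) : L2Half) =ᵐ[halfLine] fun x => ∫ r, c r * A (r + s + x) := by
  -- Both sides are compared through their integrals over sets of finite measure, that is, through
  -- inner products with indicators.
  have hind : ∀ (S : Set ℝ) (hS : MeasurableSet S) (hS' : halfLine S ≠ ⊤),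
      (fun x => (∫ r, c r * A (r + s + x)) * indicatorConstLp 2 hS hS' (1 : ℝ) x) =ᵐ[halfLine]
        S.indicator fun x => ∫ r, c r * A (r + s + x) := fun S hS hS' => by
    filter_upwards [indicatorConstLp_coeFn (p := 2) (hs := hS) (hμs := hS') (c := (1 : ℝ))]
      with x hx
    rw [hx]
    by_cases h : x ∈ S <;> simp [h]
  refine ae_eq_of_forall_setIntegral_eq_of_sigmaFinite (fun S hS hS' => ?_) (fun S hS hS' => ?_)
    fun S hS hS' => ?_
  · exact integrableOn_Lp_of_measure_ne_top _ fact_one_le_two_ennreal.elim hS'.ne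
  · rw [← integrable_indicator_iff hS]
    exact (integrable_integral_mul_translate hA hc hint _).congr (hind S hS hS'.ne)
  · rw [← integral_indicator (f := fun x => ∫ r, c r * A (r + s + x)) hS,
      ← integral_congr_ae (hind S hS hS'.ne),
      ← integral_mul_inner_translate hA hc hint, ← L2.inner_indicatorConstLp_one (𝕜 := ℝ) hS hS'.ne,
      ← integral_inner (integrable_smul_translate hA hc hint)]
    simp [inner_smul_right, real_inner_comm]

end

/-! ### Rank-one operators. -/

section Outer

variable {E : Type*} [NormedAddCommGroup E] [InnerProductSpace ℝ E]

/-- The operator `f ↦ ⟨y, f⟩ x`. -/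
def outer : E →L[ℝ] E →L[ℝ] (E →L[ℝ] E) := InnerProductSpace.rankOne ℝ

theorem outer_apply (x y f : E) : outer x y f = inner ℝ y f • x := rfl

theorem norm_outer (x y : E) : ‖outer x y‖ = ‖x‖ * ‖y‖ :=
  InnerProductSpace.norm_rankOne x y

theorem hasDerivAt_outer {f : ℝ → E} {f' : E} {w : ℝ} (h : HasDerivAt f f' w) :
    HasDerivAt (fun w => outer (f w) (f w)) (outer (f w) f' + outer f' (f w)) w :=
  outer.hasDerivAt_of_bilinear (fun _ => h) (fun _ => h)

theorem continuous_outer {X : Type*} [TopologicalSpace X] {f g : X → E} (hf : Continuous f)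
    (hg : Continuous g) : Continuous fun x => outer (f x) (g x) :=
  (outer.continuous.comp hf).clm_apply hg

end Outer

attribute [irreducible] outer

/-- The operator `∫ σ(r) |φ⟩⟨φ| dr` with `φ = A(r + s + ·)`. -/
def kernelOp (A σ : ℝ → ℝ) (s : ℝ) : L2Half →L[ℝ] L2Half :=
  ∫ r, σ r • outer (translate A 0 (r + s)) (translate A 0 (r + s))

/-- The vector `∫ σ(r) A(r + s) φ dr` with `φ = A(r + s + ·)`. -/
def column (A σ : ℝ → ℝ) (s : ℝ) : L2Half :=
  ∫ r, σ r • A (r + s) • translate A 0 (r + s)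

/-! ### Identification of `K₂` and `K₂(·, 0)` with Bochner integrals. -/

section

variable {A σ : ℝ → ℝ} {γ : ℝ} (hA : IsProfile A) (hσ : IsWeight σ γ)
  (hHS : ∀ p ≤ 1, ∀ s : ℝ, IsHilbertSchmidt A σ p s)
include hA

theorem IsProfile.continuous : Continuous A := by
  simpa using hA.continuous_iteratedDeriv 0

include hσ hHS

/-- Integrability against `σ` of functions dominated by the square of the envelope. -/
theorem integrable_smul_of_norm_le_envelope {E : Type*} [NormedAddCommGroup E] [NormedSpace ℝ E]
    {F : ℝ → E} (hF : AEStronglyMeasurable F) {s C : ℝ}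
    (h : ∀ r, ‖F r‖ ≤ C * envelope A (r + s) ^ 2) : Integrable fun r => σ r • F r := by
  refine ((integrable_mul_envelope_sq hA hσ hHS s).const_mul C).mono'
    (hσ.measurable.aestronglyMeasurable.smul hF) (ae_of_all _ fun r => ?_)
  rw [norm_smul, Real.norm_of_nonneg (hσ.nonneg r), mul_left_comm]
  exact mul_le_mul_of_nonneg_left (h r) (hσ.nonneg r)

omit hA hσ hHS in
theorem norm_outer_translate_le (w : ℝ) :
    ‖outer (translate A 0 w) (translate A 0 w)‖ ≤ envelope A w ^ 2 := by
  rw [norm_outer, sq]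
  exact mul_le_mul (norm_translate_zero_le w) (norm_translate_zero_le w) (norm_nonneg _)
    (envelope_nonneg w)

omit hσ hHS in
theorem continuous_outer_translate :
    Continuous fun w => outer (translate A 0 w) (translate A 0 w) :=
  continuous_outer (continuous_translate hA 0) (continuous_translate hA 0)

theorem integrable_outer_translate (s : ℝ) :
    Integrable fun r => σ r • outer (translate A 0 (r + s)) (translate A 0 (r + s)) :=
  integrable_smul_of_norm_le_envelope hA hσ hHS
    ((continuous_outer_translate hA).comp (continuous_add_const s)).aestronglyMeasurable
    fun _ => (norm_outer_translate_le _).trans_eq (one_mul _).symm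

theorem kernelOp_apply (s : ℝ) (f : L2Half) :
    kernelOp A σ s f =
      ∫ r, (σ r * inner ℝ (translate A 0 (r + s)) f) • translate A 0 (r + s) := by
  rw [kernelOp, ContinuousLinearMap.integral_apply (integrable_outer_translate hA hσ hHS s)]
  simp [outer_apply, smul_smul]

omit hσ hHS in
theorem continuous_inner_translate (p : ℕ) (s : ℝ) (f : L2Half) :
    Continuous fun r => inner ℝ (translate A p (r + s)) f :=
  ((continuous_translate hA p).comp (continuous_add_const s)).inner continuous_const

theorem integrable_inner_mul_norm (s : ℝ) (f : L2Half) :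
    Integrable fun r =>
      σ r * inner ℝ (translate A 0 (r + s)) f * ‖translate A 0 (r + s)‖ := by
  simp only [mul_assoc]
  refine integrable_smul_of_norm_le_envelope (s := s) (C := ‖f‖) hA hσ hHS
    ((continuous_inner_translate hA 0 s f).mul
      ((continuous_translate hA 0).comp (continuous_add_const s)).norm).aestronglyMeasurable
    fun r => ?_
  rw [norm_mul, norm_norm]
  calc _ ≤ (‖translate A 0 (r + s)‖ * ‖f‖) * ‖translate A 0 (r + s)‖ := by
        gcongr; exact norm_inner_le_norm _ _
    _ = ‖f‖ * ‖translate A 0 (r + s)‖ ^ 2 := by ring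
    _ ≤ _ := by gcongr; exact norm_translate_zero_le _

omit hσ hHS in
theorem abs_le_envelope_of_le {x s : ℝ} (hx : 0 ≤ x) (r : ℝ) :
    |A (r + s + x)| ≤ envelope A (r + s) :=
  (abs_le_envelope hA _).trans (antitone_envelope hA (by linarith))

theorem integrable_apply_mul_norm (s : ℝ) {x : ℝ} (hx : 0 ≤ x) :
    Integrable fun r => σ r * A (r + s + x) * ‖translate A 0 (r + s)‖ := by
  simp only [mul_assoc]
  refine integrable_smul_of_norm_le_envelope (s := s) (C := 1) hA hσ hHS
    (((hA.continuous.comp (by fun_prop)).mul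
      ((continuous_translate hA 0).comp (continuous_add_const s)).norm).aestronglyMeasurable)
    fun r => ?_
  rw [norm_mul, norm_norm, one_mul, sq]
  exact mul_le_mul (abs_le_envelope_of_le hA hx r) (norm_translate_zero_le _) (norm_nonneg _)
    (envelope_nonneg _)

/-- The Bochner integral applied to `f` is evaluated at almost every `x`, and Fubini then brings the
integral over `r` inside. The condition `x > 0` lets the envelope at `r + s` control `A (r + s +
x)`. -/
theorem isIntegralOperator_kernelOp (s : ℝ) :
    IsIntegralOperator (kernelK A σ s) (kernelOp A σ s) := by
  intro f
  have hm : Measurable fun r => σ r * inner ℝ (translate A 0 (r + s)) f :=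
    hσ.measurable.mul (continuous_inner_translate hA 0 s f).measurable
  rw [kernelOp_apply hA hσ hHS]
  filter_upwards [integral_smul_translate_coeFn hA hm (integrable_inner_mul_norm hA hσ hHS s f),
    ae_restrict_mem measurableSet_Ioi] with x hx hx0
  have hm' : Measurable fun r => σ r * A (r + s + x) :=
    hσ.measurable.mul (hA.continuous.comp (by fun_prop)).measurable
  have hi := integrable_apply_mul_norm hA hσ hHS s (le_of_lt hx0)
  have hk : ∀ y, kernelK A σ s x y = ∫ r, σ r * A (r + s + x) * A (r + s + y) := fun y => by
    unfold kernelK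
    congr 1; ext r
    rw [add_right_comm r x, add_right_comm r y]; ring
  simp only [hk]
  refine ⟨integrable_integral_mul_translate hA hm' hi f, ?_⟩
  rw [hx, ← integral_mul_inner_translate hA hm' hi f]
  congr 1; ext r; ring

/-- A kernel determines its operator, so the choice made in `opK` is immaterial. -/
theorem opK_eq_kernelOp (s : ℝ) : opK A σ s = kernelOp A σ s := by
  have h : ∃ T, IsIntegralOperator (kernelK A σ s) T :=
    ⟨_, isIntegralOperator_kernelOp hA hσ hHS s⟩
  rw [opK, dif_pos h]
  ext1 f
  refine Lp.ext ?_
  filter_upwards [h.choose_spec f, isIntegralOperator_kernelOp hA hσ hHS s f] with x h1 h2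
  rw [h1.2, h2.2]

theorem column_coeFn (s : ℝ) : column A σ s =ᵐ[halfLine] fun x => kernelK A σ s x 0 := by
  have hm : Measurable fun r => σ r * A (r + s) :=
    hσ.measurable.mul (hA.continuous.comp (by fun_prop)).measurable
  have hi := integrable_apply_mul_norm hA hσ hHS s le_rfl
  simp only [add_zero] at hi
  have := integral_smul_translate_coeFn hA hm hi
  simp only [mul_smul] at this
  refine this.trans (ae_of_all _ fun x => ?_)
  simp only [kernelK, add_zero]
  congr 1; ext r
  rw [add_right_comm r x]; ring

theorem memLp_kernelK (s : ℝ) : MemLp (fun x => kernelK A σ s x 0) 2 halfLine :=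
  (memLp_congr_ae (column_coeFn hA hσ hHS s)).1 (Lp.memLp _)

theorem toL2_kernelK (s : ℝ) : toL2 (fun x => kernelK A σ s x 0) = column A σ s :=
  Lp.ext ((toL2_coeFn (memLp_kernelK hA hσ hHS s)).trans (column_coeFn hA hσ hHS s).symm)

theorem wellDefined (s : ℝ) : WellDefined A σ s where
  kernel x hx y hy := by
    refine (integrable_smul_of_norm_le_envelope (s := s) (C := 1)
      (F := fun r => A (r + s + x) * A (r + s + y)) hA hσ hHS
      ((hA.continuous.comp (by fun_prop)).mul (hA.continuous.comp (by fun_prop))).aestronglyMeasurable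
      fun r => ?_).congr (ae_of_all _ fun r => ?_)
    · rw [norm_mul, one_mul, sq]
      exact mul_le_mul (abs_le_envelope_of_le hA hx r) (abs_le_envelope_of_le hA hy r)
        (norm_nonneg _) (envelope_nonneg _)
    · simp only [smul_eq_mul]
      rw [add_right_comm r x, add_right_comm r y]; ring
  operator := opK_eq_kernelOp hA hσ hHS s ▸ isIntegralOperator_kernelOp hA hσ hHS s
  column := memLp_kernelK hA hσ hHS s
  row p t := by
    refine (memLp_congr_ae (ae_of_all _ fun y => ?_)).1 (hA.memLp p (t + s))
    simp only [add_right_comm t y]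

end

/-! ### Derivatives of `K₂` and of its column in `s`. -/

section

variable {A σ : ℝ → ℝ} {γ : ℝ} (hA : IsProfile A) (hσ : IsWeight σ γ)
  (hHS : ∀ p ≤ 1, ∀ s : ℝ, IsHilbertSchmidt A σ p s)
include hA

theorem norm_smul_translate_le (w : ℝ) : ‖A w • translate A 0 w‖ ≤ envelope A w ^ 2 := by
  rw [norm_smul, sq]
  exact mul_le_mul (abs_le_envelope hA w) (norm_translate_zero_le w) (norm_nonneg _)
    (envelope_nonneg w)

theorem continuous_smul_translate : Continuous fun w => A w • translate A 0 w :=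
  hA.continuous.smul (continuous_translate hA 0)

include hσ hHS

theorem integrable_dWeight_of_norm_le_envelope {E : Type*} [NormedAddCommGroup E]
    {F : ℝ → E} (hF : Continuous F) (h : ∀ w, ‖F w‖ ≤ envelope A w ^ 2) (s : ℝ) :
    Integrable (fun v => F (v + s)) (dWeight hσ.mono) :=
  (integrable_envelope_sq_dWeight hA hσ hHS s).mono'
    (hF.comp (continuous_add_const s)).aestronglyMeasurable (ae_of_all _ fun v => h (v + s))

/-- The form of `K₂'` with the derivative on `σ`, which produces the `σ'` term in the equation for
`q_p`. -/
theorem hasDerivAt_kernelOp_dWeight (s : ℝ) :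
    HasDerivAt (kernelOp A σ)
      (-∫ v, outer (translate A 0 (v + s)) (translate A 0 (v + s)) ∂(dWeight hσ.mono)) s :=
  hσ.hasDerivAt_integral_smul (continuous_outer_translate hA) norm_outer_translate_le
    (antitone_envelope_sq hA) (integrable_mul_envelope_sq hA hσ hHS)
    (integrable_envelope_sq_dWeight hA hσ hHS) s

theorem hasDerivAt_column (s : ℝ) :
    HasDerivAt (column A σ)
      (-∫ v, A (v + s) • translate A 0 (v + s) ∂(dWeight hσ.mono)) s :=
  hσ.hasDerivAt_integral_smul (continuous_smul_translate hA) (norm_smul_translate_le hA)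
    (antitone_envelope_sq hA) (integrable_mul_envelope_sq hA hσ hHS)
    (integrable_envelope_sq_dWeight hA hσ hHS) s

omit hA hσ hHS in
theorem norm_outer_add_outer_le (w : ℝ) :
    ‖outer (translate A 0 w) (translate A 1 w) + outer (translate A 1 w) (translate A 0 w)‖ ≤
      2 * envelope A w ^ 2 := by
  refine (norm_add_le _ _).trans ?_
  have := mul_le_mul (norm_translate_zero_le (A := A) w) (norm_translate_one_le (A := A) w) (norm_nonneg _)
    (envelope_nonneg w)
  rw [norm_outer, norm_outer, mul_comm ‖translate A 1 w‖, sq]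
  linarith

omit hσ hHS in
theorem hasDerivAt_outer_translate (w : ℝ) :
    HasDerivAt (fun w => outer (translate A 0 w) (translate A 0 w))
      (outer (translate A 0 w) (translate A 1 w) + outer (translate A 1 w) (translate A 0 w)) w :=
  hasDerivAt_outer (hasDerivAt_translate hA 0 w)

omit hσ hHS in
theorem continuous_outer_add_outer : Continuous fun w =>
    outer (translate A 0 w) (translate A 1 w) + outer (translate A 1 w) (translate A 0 w) :=
  (continuous_outer (continuous_translate hA 0) (continuous_translate hA 1)).add
    (continuous_outer (continuous_translate hA 1) (continuous_translate hA 0))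

theorem integrable_outer_add_outer (s : ℝ) : Integrable fun r => σ r •
    (outer (translate A 0 (r + s)) (translate A 1 (r + s)) +
      outer (translate A 1 (r + s)) (translate A 0 (r + s))) :=
  integrable_smul_of_norm_le_envelope hA hσ hHS
    ((continuous_outer_add_outer hA).comp (continuous_add_const s)).aestronglyMeasurable
    fun _ => norm_outer_add_outer_le _

/-- The form of `K₂'` with the derivative on the translates, suited to integration by parts in `x`
and used for `u_p`. -/
theorem hasDerivAt_kernelOp (s : ℝ) :
    HasDerivAt (kernelOp A σ)
      (∫ r, σ r • (outer (translate A 0 (r + s)) (translate A 1 (r + s)) +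
        outer (translate A 1 (r + s)) (translate A 0 (r + s)))) s := by
  refine (hasDerivAt_integral_of_dominated_loc_of_deriv_le
    (F' := fun s r => σ r • (outer (translate A 0 (r + s)) (translate A 1 (r + s)) +
        outer (translate A 1 (r + s)) (translate A 0 (r + s))))
    (bound := fun r => 2 * (σ r * envelope A (r + (s - 1)) ^ 2))
    (Ioi_mem_nhds (sub_one_lt s)) (Eventually.of_forall fun s' => ?_) ?_ ?_ ?_
    ((integrable_mul_envelope_sq hA hσ hHS _).const_mul 2) ?_).2
  · exact (integrable_outer_translate hA hσ hHS s').aestronglyMeasurable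
  · exact integrable_outer_translate hA hσ hHS s
  · exact (integrable_outer_add_outer hA hσ hHS s).aestronglyMeasurable
  · refine ae_of_all _ fun r x hx => ?_
    rw [norm_smul, Real.norm_of_nonneg (hσ.nonneg r), mul_left_comm]
    refine mul_le_mul_of_nonneg_left ((norm_outer_add_outer_le _).trans ?_) (hσ.nonneg r)
    have := antitone_envelope_sq hA (a := r + (s - 1)) (b := r + x)
      (by have := mem_Ioi.1 hx; linarith)
    simpa using this
  · exact ae_of_all _ fun r x _ =>
      ((hasDerivAt_outer_translate hA (r + x)).comp_const_add r x).const_smul (σ r)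

theorem inner_kernelOp (s : ℝ) (f g : L2Half) :
    inner ℝ f (kernelOp A σ s g) =
      ∫ r, σ r * (inner ℝ (translate A 0 (r + s)) g * inner ℝ f (translate A 0 (r + s))) := by
  have hm : Measurable fun r => σ r * inner ℝ (translate A 0 (r + s)) g :=
    hσ.measurable.mul (continuous_inner_translate hA 0 s g).measurable
  rw [kernelOp_apply hA hσ hHS, ← integral_inner
    (integrable_smul_translate hA hm (integrable_inner_mul_norm hA hσ hHS s g))]
  simp [inner_smul_right, mul_assoc]

theorem kernelOp_symm (s : ℝ) (f g : L2Half) :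
    inner ℝ (kernelOp A σ s f) g = inner ℝ f (kernelOp A σ s g) := by
  rw [real_inner_comm, inner_kernelOp hA hσ hHS, inner_kernelOp hA hσ hHS]
  congr 1; ext r
  rw [real_inner_comm g, real_inner_comm f]; ring

theorem integrable_smul_column (s : ℝ) :
    Integrable fun r => σ r • A (r + s) • translate A 0 (r + s) :=
  integrable_smul_of_norm_le_envelope hA hσ hHS
    ((continuous_smul_translate hA).comp (continuous_add_const s)).aestronglyMeasurable
    fun _ => (norm_smul_translate_le hA _).trans_eq (one_mul _).symm

/-- The vector `∫ σ(r) ⟨φ, g⟩ φ' dr` with `φ = A(r + s + ·)`, the derivative of `K₂ g`. -/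
def derivKernelOp (A σ : ℝ → ℝ) (s : ℝ) (g : L2Half) : L2Half :=
  ∫ r, σ r • outer (translate A 1 (r + s)) (translate A 0 (r + s)) g

omit hσ hHS in
theorem continuous_outer_apply (p p' : ℕ) (s : ℝ) (g : L2Half) : Continuous fun r =>
    outer (translate A p (r + s)) (translate A p' (r + s)) g := by
  simp only [outer_apply]
  exact (continuous_inner_translate hA p' s g).smul
    ((continuous_translate hA p).comp (continuous_add_const s))

theorem integrable_outer_apply {p p' : ℕ} (hp : ∀ w, ‖translate A p w‖ ≤ envelope A w)
    (hp' : ∀ w, ‖translate A p' w‖ ≤ envelope A w) (s : ℝ) (g : L2Half) :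
    Integrable fun r => σ r • outer (translate A p (r + s)) (translate A p' (r + s)) g := by
  refine integrable_smul_of_norm_le_envelope (s := s) (C := ‖g‖) hA hσ hHS
    (continuous_outer_apply hA p p' s g).aestronglyMeasurable fun r => ?_
  refine (ContinuousLinearMap.le_opNorm _ _).trans ?_
  rw [norm_outer, mul_comm, sq]
  gcongr
  · exact envelope_nonneg _
  · exact hp _
  · exact hp' _

/-- Collected under one integral, the left side matches what integration by parts gives for `∫ σ
⟨φ', g⟩ φ`, with `a = q_0(t')` and `f` the `x`-derivative of `g`. -/
theorem neg_smul_column_sub_kernelOp (s a : ℝ) (f : L2Half) :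
    -(a • column A σ s) - kernelOp A σ s f = ∫ r, σ r •
      (-(a * A (r + s)) - inner ℝ (translate A 0 (r + s)) f) • translate A 0 (r + s) := by
  have hc : Integrable fun r => -(a • σ r • A (r + s) • translate A 0 (r + s)) :=
    ((integrable_smul_column hA hσ hHS s).smul a).neg
  have hi := integrable_outer_apply hA hσ hHS norm_translate_zero_le norm_translate_zero_le s f
  simp only [outer_apply] at hi
  rw [kernelOp_apply hA hσ hHS, column, ← integral_smul, ← integral_neg]
  simp only [mul_smul]
  rw [← integral_sub hc hi]
  congr 1; ext1 r
  module

/-- Integration by parts against `K₂ g`. -/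
theorem inner_translate_succ_kernelOp (p : ℕ) (w s : ℝ) (g : L2Half) :
    inner ℝ (translate A (p + 1) w) (kernelOp A σ s g) +
      inner ℝ (translate A p w) (derivKernelOp A σ s g) =
        -(iteratedDeriv p A w * inner ℝ (column A σ s) g) := by
  have h0 := integrable_outer_apply hA hσ hHS norm_translate_zero_le norm_translate_zero_le s g
  have h1 := integrable_outer_apply hA hσ hHS norm_translate_one_le norm_translate_zero_le s g
  rw [kernelOp, ContinuousLinearMap.integral_apply (integrable_outer_translate hA hσ hHS s),
    derivKernelOp, column, real_inner_comm g,
    ← integral_inner (integrable_smul_column hA hσ hHS s), ← integral_const_mul, ← integral_neg,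
    ← integral_inner h1]
  simp only [_root_.smul_apply]
  rw [← integral_inner h0, ← integral_add (h0.const_inner _) (h1.const_inner _)]
  congr 1; ext r
  have h := inner_translate_succ_add hA p 0 w (r + s)
  rw [iteratedDeriv_zero, zero_add] at h
  simp only [outer_apply, inner_smul_right, real_inner_comm g]
  linear_combination σ r * inner ℝ g (translate A 0 (r + s)) * h

/-! ### The resolvent and the two equations of the hierarchy. -/

omit hA hσ hHS in
theorem resolvent_mul_cancel {s : ℝ} (hU : IsUnit (1 - opK A σ s)) (f : L2Half) :
    resolvent A σ s (f - opK A σ s f) = f :=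
  DFunLike.congr_fun (Ring.inverse_mul_cancel _ hU) f

omit hA hσ hHS in
theorem sub_opK_resolvent {s : ℝ} (hU : IsUnit (1 - opK A σ s)) (f : L2Half) :
    resolvent A σ s f - opK A σ s (resolvent A σ s f) = f :=
  DFunLike.congr_fun (Ring.mul_inverse_cancel _ hU) f

theorem resolvent_symm {s : ℝ} (hU : IsUnit (1 - opK A σ s)) (f g : L2Half) :
    inner ℝ (resolvent A σ s f) g = inner ℝ f (resolvent A σ s g) := by
  conv_lhs => rw [← sub_opK_resolvent hU g]
  conv_rhs => rw [← sub_opK_resolvent hU f]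
  rw [inner_sub_left, inner_sub_right, opK_eq_kernelOp hA hσ hHS, kernelOp_symm hA hσ hHS]

-- Inversion has derivative `H ↦ -U⁻¹ H U⁻¹` at a unit `U`; its sign cancels that of `I - K₂`.
-- Invertibility at the single point `s` is enough.
omit hA hσ hHS in
theorem hasDerivAt_resolvent {s : ℝ} (hU : IsUnit (1 - opK A σ s)) {K' : L2Half →L[ℝ] L2Half}
    (h : HasDerivAt (opK A σ) K' s) :
    HasDerivAt (resolvent A σ) (resolvent A σ s * K' * resolvent A σ s) s := by
  obtain ⟨U, hU⟩ := hU
  have h1 := hasFDerivAt_ringInverse (𝕜 := ℝ) U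
  rw [hU] at h1
  have h2 := h1.comp_hasDerivAt s (h.const_sub 1)
  have h3 : (↑U⁻¹ : L2Half →L[ℝ] L2Half) = resolvent A σ s := by
    rw [resolvent, ← hU, Ring.inverse_unit]
  rw [h3] at h2
  convert! h2 using 1
  simp [ContinuousLinearMap.mulLeftRight_apply]

theorem q_eq (p : ℕ) (s t : ℝ) :
    q A σ p s t = iteratedDeriv p A (t + s) +
      inner ℝ (translate A p (t + s)) (resolvent A σ s (column A σ s)) := by
  rw [q, row_eq_translate, toL2_kernelK hA hσ hHS]

omit hA hσ hHS in
theorem u_eq (p : ℕ) (s t t' : ℝ) :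
    u A σ p s t t' =
      inner ℝ (translate A p (t + s)) (resolvent A σ s (translate A 0 (t' + s))) := by
  rw [u, row_eq_translate, row_eq_translate]

omit hσ hHS in
theorem hasDerivAt_translate_add (p : ℕ) (t s : ℝ) :
    HasDerivAt (fun s => translate A p (t + s)) (translate A (p + 1) (t + s)) s :=
  (hasDerivAt_translate hA p (t + s)).comp_const_add t s

theorem hasDerivAt_q {s : ℝ} (hU : IsUnit (1 - opK A σ s)) (p : ℕ) (t : ℝ) :
    Integrable (fun v => u A σ p s t v * q A σ 0 s v) (dWeight hσ.mono) ∧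
      HasDerivAt (fun s' => q A σ p s' t)
        (q A σ (p + 1) s t - ∫ v, u A σ p s t v * q A σ 0 s v ∂(dWeight hσ.mono)) s := by
  set R := resolvent A σ s
  set k := column A σ s
  let L : L2Half →L[ℝ] ℝ := (innerSL ℝ (translate A p (t + s))).comp R
  have hL : ∀ f, L f = inner ℝ (translate A p (t + s)) (R f) := fun f => rfl
  have hi1 := integrable_dWeight_of_norm_le_envelope hA hσ hHS (continuous_outer_translate hA)
    norm_outer_translate_le s
  have hi2 := integrable_dWeight_of_norm_le_envelope hA hσ hHS (continuous_smul_translate hA)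
    (norm_smul_translate_le hA) s
  have hi1' := hi1.apply_continuousLinearMap (R k)
  -- Here `q_0(v) = A(v+s) + ⟨φ_{v+s}, R k⟩` multiplies `L φ_{v+s} = u_p(t, v)`. Being a bounded
  -- functional, `L` gives integrability and commutes with the integral.
  have hfun : (fun v => u A σ p s t v * q A σ 0 s v) = fun v =>
      L (outer (translate A 0 (v + s)) (translate A 0 (v + s)) (R k) +
        A (v + s) • translate A 0 (v + s)) := by
    ext v
    rw [q_eq hA hσ hHS, u_eq, map_add, outer_apply, map_smul, map_smul, hL, iteratedDeriv_zero,
      smul_eq_mul, smul_eq_mul]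
    ring
  rw [hfun]
  refine ⟨L.integrable_comp (hi1'.add hi2), ?_⟩
  have hcomp := L.integral_comp_comm (hi1'.add hi2)
  simp only [Pi.add_apply] at hcomp
  rw [hcomp, integral_add hi1' hi2,
    ← ContinuousLinearMap.integral_apply hi1]
  have hK := hasDerivAt_kernelOp_dWeight hA hσ hHS s
  rw [← funext (opK_eq_kernelOp hA hσ hHS)] at hK
  have hq : (fun s' => q A σ p s' t) = fun s => iteratedDeriv p A (t + s) +
      inner ℝ (translate A p (t + s)) (resolvent A σ s (column A σ s)) := by
    ext s'; exact q_eq hA hσ hHS p s' t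
  rw [hq]
  have h1 := (hA.hasDerivAt_iteratedDeriv p (t + s)).comp_const_add t s
  have h2 := (hasDerivAt_resolvent hU hK).clm_apply (hasDerivAt_column hA hσ hHS s)
  convert! h1.add ((hasDerivAt_translate_add hA p t s).inner ℝ h2) using 1
  rw [q_eq hA hσ hHS, hL]
  simp only [R, k, _root_.mul_apply_eq_comp, _root_.neg_apply, mul_neg, neg_mul, map_neg, inner_add_right,
    inner_neg_right, map_add]
  ring

theorem hasDerivAt_u {s : ℝ} (hU : IsUnit (1 - opK A σ s)) (p : ℕ) (t t' : ℝ) :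
    HasDerivAt (fun s' => u A σ p s' t t') (-(q A σ p s t * q A σ 0 s t')) s := by
  set R := resolvent A σ s with hR
  set k := column A σ s with hk
  set g := R (translate A 0 (t' + s)) with hg
  -- The `x`-derivative of `g`, read off from `g = φ_{t'+s} + K₂ g`.
  set d := translate A 1 (t' + s) + derivKernelOp A σ s g with hd
  have hgK : g = translate A 0 (t' + s) + kernelOp A σ s g := by
    have := sub_opK_resolvent hU (translate A 0 (t' + s))
    rw [opK_eq_kernelOp hA hσ hHS] at this
    exact sub_eq_iff_eq_add.1 this
  -- The right side is the boundary value `g(0)`; self-adjointness of `R` moves it from `k` to the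
  -- translate.
  have hq0 : q A σ 0 s t' = A (t' + s) + inner ℝ k g := by
    rw [q_eq hA hσ hHS, iteratedDeriv_zero, hg, ← resolvent_symm hA hσ hHS hU,
      real_inner_comm]
  have hparts : ∀ p w, inner ℝ (translate A (p + 1) w) g + inner ℝ (translate A p w) d =
      -(iteratedDeriv p A w * q A σ 0 s t') := by
    intro p w
    have h1 := inner_translate_succ_add hA p 0 w (t' + s)
    have h2 := inner_translate_succ_kernelOp hA hσ hHS p w s g
    rw [iteratedDeriv_zero, zero_add] at h1
    rw [hq0, hgK, inner_add_right, ← hgK, hd, inner_add_right]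
    linear_combination h1 + h2
  have h01 := integrable_outer_apply hA hσ hHS norm_translate_zero_le norm_translate_one_le s g
  have h10 := integrable_outer_apply hA hσ hHS norm_translate_one_le norm_translate_zero_le s g
  -- `hparts` with `p = 0`, applied under the integral, trades `⟨φ', g⟩` for `⟨φ, d⟩` and a boundary
  -- term.
  have hcomm : ∫ r, σ r • outer (translate A 0 (r + s)) (translate A 1 (r + s)) g =
      -(q A σ 0 s t' • k) - kernelOp A σ s d := by
    rw [hk, neg_smul_column_sub_kernelOp hA hσ hHS]
    congr 1; ext1 r
    have h := hparts 0 (r + s)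
    rw [iteratedDeriv_zero, zero_add] at h
    rw [outer_apply, eq_sub_of_add_eq h, mul_comm]
  have hK := hasDerivAt_kernelOp hA hσ hHS s
  rw [← funext (opK_eq_kernelOp hA hσ hHS)] at hK
  have hu : (fun s' => u A σ p s' t t') = fun s =>
      inner ℝ (translate A p (t + s)) (resolvent A σ s (translate A 0 (t' + s))) := by
    ext s'; exact u_eq p s' t t'
  rw [hu]
  have h2 := (hasDerivAt_resolvent hU hK).clm_apply (hasDerivAt_translate_add hA 0 t' s)
  convert! (hasDerivAt_translate_add hA p t s).inner ℝ h2 using 1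
  rw [← hR, _root_.mul_apply_eq_comp, _root_.mul_apply_eq_comp, ← hg, ← map_add,
    ContinuousLinearMap.integral_apply (integrable_outer_add_outer hA hσ hHS s)]
  simp only [_root_.smul_apply, _root_.add_apply, smul_add]
  rw [integral_add h01 h10, hcomm, ← derivKernelOp, zero_add]
  -- The factor `I - K₂` in front of `d` cancels against `R`, so no resolvent acts on `d` and
  -- `hparts` applies once more.
  have hsum : -(q A σ 0 s t' • k) - kernelOp A σ s d + derivKernelOp A σ s g +
      translate A 1 (t' + s) = (d - opK A σ s d) - q A σ 0 s t' • k := by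
    rw [opK_eq_kernelOp hA hσ hHS, hd]; abel
  rw [hsum, map_sub, resolvent_mul_cancel hU, map_smul, inner_sub_right, inner_smul_right,
    q_eq hA hσ hHS p]
  linear_combination -hparts p (t + s)

end

end InhomHierarchy

end

theorem mainTheorem4 (A σ : ℝ → ℝ) (γ : ℝ)
    (hA : InhomHierarchy.IsProfile A) (hσ : InhomHierarchy.IsWeight σ γ)
    (hHS : ∀ p ≤ 1, ∀ s : ℝ, InhomHierarchy.IsHilbertSchmidt A σ p s) (s : ℝ) :
    InhomHierarchy.WellDefined A σ s ∧
    (IsUnit (1 - InhomHierarchy.opK A σ s) →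
      ∀ p : ℕ,
        (∀ t : ℝ,
          Integrable (fun v => InhomHierarchy.u A σ p s t v * InhomHierarchy.q A σ 0 s v)
            (InhomHierarchy.dWeight hσ.mono) ∧
          HasDerivAt (fun s' => InhomHierarchy.q A σ p s' t)
            (InhomHierarchy.q A σ (p + 1) s t -
              ∫ v, InhomHierarchy.u A σ p s t v * InhomHierarchy.q A σ 0 s v
                ∂(InhomHierarchy.dWeight hσ.mono)) s) ∧
        (∀ t t' : ℝ,
          HasDerivAt (fun s' => InhomHierarchy.u A σ p s' t t')
            (-(InhomHierarchy.q A σ p s t * InhomHierarchy.q A σ 0 s t')) s)) :=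
  ⟨InhomHierarchy.wellDefined hA hσ hHS s, fun hU p =>
    ⟨fun t => InhomHierarchy.hasDerivAt_q hA hσ hHS hU p t,
      fun t t' => InhomHierarchy.hasDerivAt_u hA hσ hHS hU p t t'⟩⟩
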